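/- Let $d\in\{2,3\}$ and let $\Omega\subset\mathbb R^d$ be a bounded open set (for instance a Lipschitz domain with polyhedral boundary). Write $W_0^{1,2}(\Omega)^d$ for the closure of $C_c^\infty(\Omega)^d$ in $W^{1,2}(\Omega)^d$, with norm $\|u\|_{1,2}=\|\nabla u\|_2$, put $\mathrm D u=\tfrac12(\nabla u+(\nabla u)^{\mathrm T})$ with $(\nabla u)_{ij}=\partial_i u_j$, and $$\mathcal B[v,w,h]=\frac12\int_\Omega (v\otimes h):\nabla w-(v\otimes w):\nabla h\,dx .$$ For $N\in\mathbb N$ let $\mathcal T_N$ be a conforming triangulation of $\overline\Omega$ into finitely many closed simplices. Let $\mathbb P_{\mathbb V}(K)$ and $\mathbb P_{\mathbb Q}(K)$ be linear spaces of polynomials, given for each simplex $K$, with $\mathbb P_1^d\subseteq\mathbb P_{\mathbb V}(K)\subseteq\mathbb P_{i^\star}^d$ and $\mathbb P_0\subseteq\mathbb P_{\mathbb Q}(K)\subseteq\mathbb P_{j^\star}$ for some $i^\star\ge j^\star\ge 0$, where $\mathbb P_m$ denotes the polynomials of degree at most $m$. Put $$\mathbb V(\mathcal T_N)=\{V\in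 W_0^{1,2}(\Omega)^d: V|_K\in\mathbb P_{\mathbb V}(K)\ \forall K\in\mathcal T_N\},\qquad \mathbb Q(\mathcal T_N)=\{Q\in L^\infty(\Omega): Q|_K\in\mathbb P_{\mathbb Q}(K)\ \forall K\in\mathcal T_N\},$$ $$\mathbb V_0(\mathcal T_N)=\Big\{V\in\mathbb V(\mathcal T_N):\int_\Omega Q\,\mathrm{div} V\,dx=0\ \forall Q\in\mathbb Q(\mathcal T_N)\Big\}.$$ Let $\sigma\ge 0$, $\nu>0$ and $f\in L^2(\Omega)^d$. For $n=1,2,\dots$ and $U\in\mathbb V(\mathcal T_N)$ define $\mathrm F_N^n(U)\in\mathbb V(\mathcal T_N)^\star$ by $$\langle \mathrm F_N^n(U),V\rangle=\int_\Omega\Big(\frac{\sigma}{\sqrt{|\mathrm D U|^2+n^{-2}}}+2\nu\Big)\mathrm D U:\mathrm D V\,dx+\mathcal B[U,U,V]-\int_\Omega f\cdot V\,dx .$$ Let $\mathrm J:\mathbb V_0(\mathcal T_N)\to\mathbb V_0(\mathcal T_N)^\star$ be the Riesz map $\mathrm J(U)(V)=\int_\Omega \mathrm D U:\mathrm D V\,dx$;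 for $\delta>0$ let the Zarantonello map $\mathrm T_N^n:\mathbb V_0(\mathcal T_N)\to\mathbb V_0(\mathcal T_N)$ be $$\mathrm T_N^n(U)=U-\delta\,\mathrm J^{-1}\mathrm F_N^n(U),$$ with $\mathrm F_N^n(U)$ restricted to $\mathbb V_0(\mathcal T_N)$. Let $B_R^N=\{U\in\mathbb V_0(\mathcal T_N):\|\mathrm D U\|_2\le R\}$ and $$\|f\|_{\star,N}=\sup_{V\in\mathbb V_0(\mathcal T_N)\setminus\{0\}}\frac{\int_\Omega f\cdot V\,dx}{\|\mathrm D V\|_2}$$ (which is $0$ if $\mathbb V_0(\mathcal T_N)=\{0\}$). For $C>0$ and $F<\nu^2/(2\sqrt2\,C)$ put $$R_\mp(C,F)=\frac{\nu\mp\sqrt{\nu^2-2\sqrt2\,C F}}{2\sqrt2\,C}.$$ Then there is a constant $C_{\mathcal B}>0$ with $$\mathcal B[v,w,h]\le C_{\mathcal B}\|v\|_{1,2}\|w\|_{1,2}\|h\|_{1,2}\qquad\text{for all } v,w,h\in W_0^{1,2}(\Omega)^d,\tag{1}$$ for every $N$ the map $\mathrm J$ is bijective (so that $\mathrm T_N^n$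 is well defined), and for every constant $C_{\mathcal B}>0$ with (1) the following hold. 1. Let $N\in\mathbb N$ and $\|f\|_{\star,N}<\nu^2/(2\sqrt2\,C_{\mathcal B})$. If $R_-(C_{\mathcal B},\|f\|_{\star,N})\le R\le R_+(C_{\mathcal B},\|f\|_{\star,N})$, then for all $n\ge1$ and all $0<\delta\le 2(4\nu+\sigma n)^{-1}$ $$\mathrm T_N^n(B_R^N)\subseteq B_R^N .$$ 2. The radius can be chosen independently of $n$ and $N$: if $\|f\|_{\star,N}\le F<\nu^2/(2\sqrt2\,C_{\mathcal B})$ for all $N\in\mathbb N$, and $R_-(C_{\mathcal B},F)\le R\le R_+(C_{\mathcal B},F)$, then $\mathrm T_N^n(B_R^N)\subseteq B_R^N$ for all $N\in\mathbb N$, all $n\ge1$ and all $0<\delta\le 2(4\nu+\sigma n)^{-1}$. -/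

import Mathlib

open MeasureTheory
open scoped ContDiff ENNReal

noncomputable section

namespace Bingham

/-- Vectors in `ℝ^d` with the Euclidean norm. -/
abbrev Vec (d : ℕ) : Type := EuclideanSpace ℝ (Fin d)

/-- Real `d × d` matrices; the norm and the inner product `A : B = ∑ i j, A i j * B i j` are those
of Frobenius. -/
abbrev Mat (d : ℕ) : Type := EuclideanSpace ℝ (Fin d × Fin d)

/-- A bounded open set of `ℝ^d`. -/
structure BoundedOpenSet (d : ℕ) where
  carrier : Set (Vec d)
  isOpen : IsOpen carrier
  isBounded : Bornology.IsBounded carrier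

variable {d : ℕ}

/-- Lebesgue measure on `Ω`. -/
abbrev BoundedOpenSet.vol (Ω : BoundedOpenSet d) : Measure (Vec d) :=
  volume.restrict Ω.carrier

instance (Ω : BoundedOpenSet d) : IsFiniteMeasure Ω.vol :=
  ⟨by rw [Measure.restrict_apply_univ]; exact Ω.isBounded.measure_lt_top⟩

/-! ### Matrix operations -/

/-- The symmetric part `(A + Aᵀ) / 2`. -/
def symPart : Mat d →L[ℝ] Mat d :=
  LinearMap.toContinuousLinearMap
    { toFun := fun A => WithLp.toLp 2 fun p => (A (p.1, p.2) + A (p.2, p.1)) / 2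
      map_add' := fun A B => by ext p; simp; ring
      map_smul' := fun c A => by ext p; simp; ring }

/-- The trace. -/
def trace (A : Mat d) : ℝ := ∑ i, A (i, i)

/-- The tensor product `(v ⊗ h) i j = v i * h j`. -/
def tensor (v h : Vec d) : Mat d := WithLp.toLp 2 fun p => v p.1 * h p.2

/-- The gradient `(∇ φ) i j = ∂ᵢ φⱼ` of a smooth vector field. -/
def gradMat (φ : Vec d → Vec d) (x : Vec d) : Mat d :=
  WithLp.toLp 2 fun p => (fderiv ℝ φ x (EuclideanSpace.single p.1 1)) p.2

/-! ### Sobolev spaces -/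

/-- Smooth functions with compact support in `Ω`. -/
def IsTest {F : Type*} [NormedAddCommGroup F] [NormedSpace ℝ F] (Ω : BoundedOpenSet d)
    (φ : Vec d → F) : Prop :=
  ContDiff ℝ ∞ φ ∧ HasCompactSupport φ ∧ tsupport φ ⊆ Ω.carrier

/-- `L²(Ω)^d × L²(Ω)^{d × d}`. A Sobolev function `u` is represented by the pair `(u, ∇ u)`. -/
abbrev L2Pair (Ω : BoundedOpenSet d) : Type := Lp (Vec d) 2 Ω.vol × Lp (Mat d) 2 Ω.vol

/-- `G i j` is the weak partial derivative `∂ᵢ uⱼ` in `Ω`. -/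
def HasWeakGradient (Ω : BoundedOpenSet d) (u : Lp (Vec d) 2 Ω.vol) (G : Lp (Mat d) 2 Ω.vol) :
    Prop :=
  ∀ φ : Vec d → ℝ, IsTest Ω φ → ∀ i j : Fin d,
    ∫ x, u x j * fderiv ℝ φ x (EuclideanSpace.single i 1) ∂Ω.vol = -∫ x, G x (i, j) * φ x ∂Ω.vol

theorem memLp_coord {ι : Type*} [Fintype ι] {μ : Measure (Vec d)}
    (u : Lp (EuclideanSpace ℝ ι) 2 μ) (j : ι) : MemLp (fun x => u x j) 2 μ :=
  (EuclideanSpace.proj j : EuclideanSpace ℝ ι →L[ℝ] ℝ).comp_memLp' (Lp.memLp u)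

theorem integrable_coord_mul {ι : Type*} [Fintype ι] {μ : Measure (Vec d)}
    (u : Lp (EuclideanSpace ℝ ι) 2 μ) (j : ι) {g : Vec d → ℝ} (hg : MemLp g 2 μ) :
    Integrable (fun x => u x j * g x) μ :=
  (memLp_coord u j).integrable_mul hg

theorem IsTest.memLp {Ω : BoundedOpenSet d} {φ : Vec d → ℝ} (h : IsTest Ω φ) :
    MemLp φ 2 Ω.vol :=
  (h.1.continuous.memLp_of_hasCompactSupport h.2.1).restrict _

theorem IsTest.memLp_fderiv {Ω : BoundedOpenSet d} {φ : Vec d → ℝ} (h : IsTest Ω φ) (e : Vec d) :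
    MemLp (fun x => fderiv ℝ φ x e) 2 Ω.vol := by
  refine (Continuous.memLp_of_hasCompactSupport ?_ ?_).restrict _
  · exact (h.1.continuous_fderiv (by simp)).clm_apply continuous_const
  · exact (h.2.1.fderiv ℝ).comp_left (g := fun L : Vec d →L[ℝ] ℝ => L e) rfl

/-- `W^{1,2}(Ω)^d`. -/
def sobolev (Ω : BoundedOpenSet d) : Submodule ℝ (L2Pair Ω) where
  carrier := {p | HasWeakGradient Ω p.1 p.2}
  zero_mem' := by
    intro φ hφ i j
    have h1 : (fun x => (0 : Lp (Vec d) 2 Ω.vol) x j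
        * fderiv ℝ φ x (EuclideanSpace.single i 1)) =ᵐ[Ω.vol] 0 := by
      filter_upwards [Lp.coeFn_zero (Vec d) 2 Ω.vol] with x hx
      rw [hx]
      simp
    have h2 : (fun x => (0 : Lp (Mat d) 2 Ω.vol) x (i, j) * φ x) =ᵐ[Ω.vol] 0 := by
      filter_upwards [Lp.coeFn_zero (Mat d) 2 Ω.vol] with x hx
      rw [hx]
      simp
    simp only [Prod.fst_zero, Prod.snd_zero]
    rw [integral_congr_ae h1, integral_congr_ae h2]
    simp
  add_mem' := by
    intro p q hp hq φ hφ i j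
    have h1 : (fun x => (p.1 + q.1) x j * fderiv ℝ φ x (EuclideanSpace.single i 1)) =ᵐ[Ω.vol]
        fun x => p.1 x j * fderiv ℝ φ x (EuclideanSpace.single i 1)
          + q.1 x j * fderiv ℝ φ x (EuclideanSpace.single i 1) := by
      filter_upwards [Lp.coeFn_add p.1 q.1] with x hx
      simp only [hx, Pi.add_apply, PiLp.add_apply, add_mul]
    have h2 : (fun x => (p.2 + q.2) x (i, j) * φ x) =ᵐ[Ω.vol]
        fun x => p.2 x (i, j) * φ x + q.2 x (i, j) * φ x := by
      filter_upwards [Lp.coeFn_add p.2 q.2] with x hx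
      simp only [hx, Pi.add_apply, PiLp.add_apply, add_mul]
    simp only [Prod.fst_add, Prod.snd_add]
    rw [integral_congr_ae h1, integral_congr_ae h2,
      integral_add (integrable_coord_mul p.1 j (hφ.memLp_fderiv _))
        (integrable_coord_mul q.1 j (hφ.memLp_fderiv _)),
      integral_add (integrable_coord_mul p.2 (i, j) hφ.memLp)
        (integrable_coord_mul q.2 (i, j) hφ.memLp), hp φ hφ i j, hq φ hφ i j]
    ring
  smul_mem' := by
    intro c p hp φ hφ i j
    have h1 : (fun x => (c • p.1) x j * fderiv ℝ φ x (EuclideanSpace.single i 1)) =ᵐ[Ω.vol]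
        fun x => c * (p.1 x j * fderiv ℝ φ x (EuclideanSpace.single i 1)) := by
      filter_upwards [Lp.coeFn_smul c p.1] with x hx
      simp [hx, mul_assoc]
    have h2 : (fun x => (c • p.2) x (i, j) * φ x) =ᵐ[Ω.vol]
        fun x => c * (p.2 x (i, j) * φ x) := by
      filter_upwards [Lp.coeFn_smul c p.2] with x hx
      simp [hx, mul_assoc]
    simp only [Prod.smul_fst, Prod.smul_snd]
    rw [integral_congr_ae h1, integral_congr_ae h2, integral_const_mul, integral_const_mul,
      hp φ hφ i j]
    ring

/-- The pairs `(φ, ∇ φ)` with `φ ∈ C_c^∞(Ω)^d`. -/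
def testPairs (Ω : BoundedOpenSet d) : Set (L2Pair Ω) :=
  {p | ∃ φ : Vec d → Vec d, IsTest Ω φ ∧ p.1 =ᵐ[Ω.vol] φ ∧ p.2 =ᵐ[Ω.vol] gradMat φ}

/-- `W₀^{1,2}(Ω)^d`, the closure of `C_c^∞(Ω)^d` in `W^{1,2}(Ω)^d`. (The set `testPairs Ω` is
itself a linear subspace, so that taking its span changes nothing.) -/
def sobolevZero (Ω : BoundedOpenSet d) : Submodule ℝ (L2Pair Ω) :=
  sobolev Ω ⊓ (Submodule.span ℝ (testPairs Ω)).topologicalClosure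

/-- `‖u‖_{1,2} = ‖∇ u‖₂`, the norm of `W₀^{1,2}(Ω)^d`. -/
def sobolevNorm {Ω : BoundedOpenSet d} (u : L2Pair Ω) : ℝ := ‖u.2‖

/-- The symmetric gradient `D u = (∇ u + (∇ u)ᵀ) / 2`, as an element of `L²(Ω)^{d × d}`. -/
def symGrad {Ω : BoundedOpenSet d} : L2Pair Ω →ₗ[ℝ] Lp (Mat d) 2 Ω.vol :=
  (symPart.compLpL 2 Ω.vol).toLinearMap ∘ₗ LinearMap.snd ℝ _ _

/-- The trilinear convection form
`𝓑[v, w, h] = (1/2) ∫ (v ⊗ h) : ∇ w - (v ⊗ w) : ∇ h`. -/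
def convection {Ω : BoundedOpenSet d} (v w h : L2Pair Ω) : ℝ :=
  (1 / 2) * ∫ x, inner ℝ (tensor (v.1 x) (h.1 x)) (w.2 x)
    - inner ℝ (tensor (v.1 x) (w.1 x)) (h.2 x) ∂Ω.vol

/-- `C` is a constant for which
`𝓑[v, w, h] ≤ C ‖v‖_{1,2} ‖w‖_{1,2} ‖h‖_{1,2}` on `W₀^{1,2}(Ω)^d`. -/
def IsConvectionBound (Ω : BoundedOpenSet d) (C : ℝ) : Prop :=
  ∀ v ∈ sobolevZero Ω, ∀ w ∈ sobolevZero Ω, ∀ h ∈ sobolevZero Ω,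
    convection v w h ≤ C * sobolevNorm v * sobolevNorm w * sobolevNorm h

/-! ### Finite element spaces -/

/-- A conforming triangulation of `Ω`: finitely many nondegenerate closed `d`-simplices, given by
their vertex sets, with union `closure Ω`, any two of which meet in the simplex spanned by their
common vertices (which is empty if there are none). -/
structure Triangulation (Ω : BoundedOpenSet d) where
  cells : Finset (Finset (Vec d))
  card_eq : ∀ K ∈ cells, K.card = d + 1
  indep : ∀ K ∈ cells, AffineIndependent ℝ ((↑) : K → Vec d)
  conforming : ∀ K ∈ cells, ∀ K' ∈ cells,
    convexHull ℝ (K : Set (Vec d)) ∩ convexHull ℝ (K' : Set (Vec d))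
      = convexHull ℝ ((K : Set (Vec d)) ∩ (K' : Set (Vec d)))
  cover : ⋃ K ∈ cells, convexHull ℝ (K : Set (Vec d)) = closure Ω.carrier

/-- The local polynomial spaces `ℙ_𝕍(K)` and `ℙ_ℚ(K)`, with
`ℙ₁^d ⊆ ℙ_𝕍(K) ⊆ ℙ_{i⋆}^d` and `ℙ₀ ⊆ ℙ_ℚ(K) ⊆ ℙ_{j⋆}` for some `i⋆ ≥ j⋆ ≥ 0`; they may depend on
the simplex `K`. -/
structure PolynomialSpaces (d : ℕ) where
  velocity : Finset (Vec d) → Submodule ℝ (Fin d → MvPolynomial (Fin d) ℝ)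
  pressure : Finset (Vec d) → Submodule ℝ (MvPolynomial (Fin d) ℝ)
  iStar : ℕ
  jStar : ℕ
  jStar_le : jStar ≤ iStar
  le_velocity : ∀ K,
    Submodule.pi Set.univ (fun _ => MvPolynomial.restrictTotalDegree (Fin d) ℝ 1) ≤ velocity K
  velocity_le : ∀ K,
    velocity K ≤ Submodule.pi Set.univ (fun _ => MvPolynomial.restrictTotalDegree (Fin d) ℝ iStar)
  le_pressure : ∀ K, MvPolynomial.restrictTotalDegree (Fin d) ℝ 0 ≤ pressure K
  pressure_le : ∀ K, pressure K ≤ MvPolynomial.restrictTotalDegree (Fin d) ℝ jStar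

variable {Ω : BoundedOpenSet d}

/-- The velocity space `𝕍(𝒯) = {V ∈ W₀^{1,2}(Ω)^d : V|_K ∈ ℙ_𝕍(K) for all K ∈ 𝒯}`. -/
def velocitySpace (P : PolynomialSpaces d) (T : Triangulation Ω) : Submodule ℝ (L2Pair Ω) where
  carrier := {V | V ∈ sobolevZero Ω ∧ ∀ K ∈ T.cells, ∃ q ∈ P.velocity K,
    ∀ᵐ x ∂Ω.vol, x ∈ convexHull ℝ (K : Set (Vec d)) →
      ∀ i, V.1 x i = MvPolynomial.eval (fun k => x k) (q i)}
  zero_mem' := by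
    refine ⟨zero_mem _, fun K _ => ⟨0, zero_mem _, ?_⟩⟩
    filter_upwards [Lp.coeFn_zero (Vec d) 2 Ω.vol] with x hx _ i
    rw [Prod.fst_zero, hx]
    simp
  add_mem' := by
    rintro U V ⟨hU, hU'⟩ ⟨hV, hV'⟩
    refine ⟨add_mem hU hV, fun K hK => ?_⟩
    obtain ⟨p, hp, hp'⟩ := hU' K hK
    obtain ⟨q, hq, hq'⟩ := hV' K hK
    refine ⟨p + q, add_mem hp hq, ?_⟩
    filter_upwards [Lp.coeFn_add U.1 V.1, hp', hq'] with x hx h1 h2 hxK i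
    simp only [Prod.fst_add, hx, Pi.add_apply, PiLp.add_apply, h1 hxK i, h2 hxK i, map_add]
  smul_mem' := by
    rintro c V ⟨hV, hV'⟩
    refine ⟨Submodule.smul_mem _ c hV, fun K hK => ?_⟩
    obtain ⟨q, hq, hq'⟩ := hV' K hK
    refine ⟨c • q, Submodule.smul_mem _ c hq, ?_⟩
    filter_upwards [Lp.coeFn_smul c V.1, hq'] with x hx h1 hxK i
    simp [hx, h1 hxK i]

/-- The pressure space `ℚ(𝒯) = {Q ∈ L^∞(Ω) : Q|_K ∈ ℙ_ℚ(K) for all K ∈ 𝒯}`. -/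
def pressureSpace (P : PolynomialSpaces d) (T : Triangulation Ω) : Set (Lp ℝ ∞ Ω.vol) :=
  {Q | ∀ K ∈ T.cells, ∃ q ∈ P.pressure K,
    ∀ᵐ x ∂Ω.vol, x ∈ convexHull ℝ (K : Set (Vec d)) → Q x = MvPolynomial.eval (fun k => x k) q}

theorem integrable_mul_trace (Q : Lp ℝ ∞ Ω.vol) (G : Lp (Mat d) 2 Ω.vol) :
    Integrable (fun x => Q x * trace (G x)) Ω.vol := by
  have h1 : MemLp (fun x => trace (G x)) 2 Ω.vol :=
    memLp_finsetSum _ fun i _ => memLp_coord G (i, i)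
  exact (h1.integrable (by norm_num)).mul_of_top_right (Lp.memLp Q)

/-- The space `𝕍₀(𝒯)` of discretely divergence-free velocities: the `V ∈ 𝕍(𝒯)` with
`∫ Q div V = 0` for all `Q ∈ ℚ(𝒯)`. -/
def divFreeSpace (P : PolynomialSpaces d) (T : Triangulation Ω) : Submodule ℝ (L2Pair Ω) where
  carrier := {V | V ∈ velocitySpace P T ∧
    ∀ Q ∈ pressureSpace P T, ∫ x, Q x * trace (V.2 x) ∂Ω.vol = 0}
  zero_mem' := by
    refine ⟨zero_mem _, fun Q _ => integral_eq_zero_of_ae ?_⟩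
    filter_upwards [Lp.coeFn_zero (Mat d) 2 Ω.vol] with x hx
    rw [Prod.snd_zero, hx]
    simp [trace]
  add_mem' := by
    rintro U V ⟨hU', hU⟩ ⟨hV', hV⟩
    refine ⟨add_mem hU' hV', fun Q hQ => ?_⟩
    have h : (fun x => Q x * trace ((U + V).2 x)) =ᵐ[Ω.vol]
        fun x => Q x * trace (U.2 x) + Q x * trace (V.2 x) := by
      filter_upwards [Lp.coeFn_add U.2 V.2] with x hx
      simp only [Prod.snd_add, hx, trace, Pi.add_apply, PiLp.add_apply,
        Finset.sum_add_distrib, mul_add]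
    rw [integral_congr_ae h, integral_add (integrable_mul_trace Q _) (integrable_mul_trace Q _),
      hU Q hQ, hV Q hQ, add_zero]
  smul_mem' := by
    rintro c V ⟨hV', hV⟩
    refine ⟨Submodule.smul_mem _ c hV', fun Q hQ => ?_⟩
    have h : (fun x => Q x * trace ((c • V).2 x)) =ᵐ[Ω.vol]
        fun x => c * (Q x * trace (V.2 x)) := by
      filter_upwards [Lp.coeFn_smul c V.2] with x hx
      simp only [Prod.smul_snd, hx, trace, Pi.smul_apply, PiLp.smul_apply, smul_eq_mul,
        ← Finset.mul_sum, mul_left_comm]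
    rw [integral_congr_ae h, integral_const_mul, hV Q hQ, mul_zero]

theorem divFreeSpace_le (P : PolynomialSpaces d) (T : Triangulation Ω) :
    divFreeSpace P T ≤ velocitySpace P T := fun _ hV => hV.1

/-! ### The discrete Bingham operator -/

/-- The regularised viscosity `σ / |A|_n + 2 ν`, where `|A|_n = √(|A|² + n⁻²)`. -/
def viscosity (σ ν : ℝ) (n : ℕ+) (A : Mat d) : ℝ :=
  σ / Real.sqrt (‖A‖ ^ 2 + ((n : ℝ) ^ 2)⁻¹) + 2 * ν

/-- `a_n(U; V, W) = ∫ (σ / |D U|_n + 2 ν) D V : D W`. -/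
def viscousForm (σ ν : ℝ) (n : ℕ+) (U V W : L2Pair Ω) : ℝ :=
  ∫ x, viscosity σ ν n (symGrad U x) * inner ℝ (symGrad V x) (symGrad W x) ∂Ω.vol

theorem continuous_viscosity (σ ν : ℝ) (n : ℕ+) :
    Continuous (viscosity σ ν n : Mat d → ℝ) := by
  have hn : (0 : ℝ) < ((n : ℝ) ^ 2)⁻¹ := by
    have : (0 : ℝ) < n := by exact_mod_cast n.pos
    positivity
  refine Continuous.add (Continuous.div continuous_const (by fun_prop) fun A => ?_)
    continuous_const
  have : 0 < ‖A‖ ^ 2 + ((n : ℝ) ^ 2)⁻¹ := by positivity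
  exact (Real.sqrt_pos.mpr this).ne'

theorem abs_viscosity_le (σ ν : ℝ) (n : ℕ+) (A : Mat d) :
    |viscosity σ ν n A| ≤ |σ| * n + |2 * ν| := by
  have hn : (0 : ℝ) < n := by exact_mod_cast n.pos
  refine (abs_add_le _ _).trans (add_le_add_left ?_ _)
  have h1 : (n : ℝ)⁻¹ ≤ Real.sqrt (‖A‖ ^ 2 + ((n : ℝ) ^ 2)⁻¹) := by
    refine Real.le_sqrt_of_sq_le ?_
    rw [inv_pow]
    nlinarith [sq_nonneg ‖A‖]
  have h2 : (0 : ℝ) < (n : ℝ)⁻¹ := inv_pos.mpr hn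
  rw [abs_div, abs_of_nonneg (Real.sqrt_nonneg _), div_le_iff₀ (h2.trans_le h1), mul_assoc]
  refine le_mul_of_one_le_right (abs_nonneg _) ?_
  calc (1 : ℝ) = n * (n : ℝ)⁻¹ := (mul_inv_cancel₀ hn.ne').symm
    _ ≤ _ := mul_le_mul_of_nonneg_left h1 hn.le

theorem integrable_viscous (σ ν : ℝ) (n : ℕ+) (U V W : Lp (Mat d) 2 Ω.vol) :
    Integrable (fun x => viscosity σ ν n (U x) * inner ℝ (V x) (W x)) Ω.vol := by
  refine (L2.integrable_inner V W).bdd_mul (c := |σ| * n + |2 * ν|) ?_ ?_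
  · exact (continuous_viscosity σ ν n).comp_aestronglyMeasurable (Lp.aestronglyMeasurable U)
  · exact Filter.Eventually.of_forall fun x => abs_viscosity_le σ ν n (U x)

theorem viscousForm_add (σ ν : ℝ) (n : ℕ+) (U V W W' : L2Pair Ω) :
    viscousForm σ ν n U V (W + W') = viscousForm σ ν n U V W + viscousForm σ ν n U V W' := by
  unfold viscousForm
  rw [← integral_add (integrable_viscous σ ν n _ _ _) (integrable_viscous σ ν n _ _ _), map_add]
  refine integral_congr_ae ?_
  filter_upwards [Lp.coeFn_add (symGrad W) (symGrad W')] with x hx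
  simp only [hx, Pi.add_apply, inner_add_right, mul_add]

theorem viscousForm_smul (σ ν : ℝ) (n : ℕ+) (U V : L2Pair Ω) (c : ℝ) (W : L2Pair Ω) :
    viscousForm σ ν n U V (c • W) = c * viscousForm σ ν n U V W := by
  unfold viscousForm
  rw [← integral_const_mul, map_smul]
  refine integral_congr_ae ?_
  filter_upwards [Lp.coeFn_smul c (symGrad W)] with x hx
  simp only [hx, Pi.smul_apply, inner_smul_right]
  ring

theorem exists_bound (P : PolynomialSpaces d) (T : Triangulation Ω) (V : velocitySpace P T) :
    ∃ M : ℝ, ∀ᵐ x ∂Ω.vol, ‖V.1.1 x‖ ≤ M := by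
  obtain ⟨_, hV⟩ := V.2
  have key : ∀ K ∈ T.cells, ∃ M : ℝ, ∀ᵐ x ∂Ω.vol, x ∈ convexHull ℝ (K : Set (Vec d)) →
      ‖V.1.1 x‖ ≤ M := by
    intro K hK
    obtain ⟨q, _, hq⟩ := hV K hK
    have hc : IsCompact (convexHull ℝ (K : Set (Vec d))) :=
      K.finite_toSet.isCompact_convexHull ℝ
    have hcont : Continuous fun x : Vec d =>
        (WithLp.toLp 2 fun i => MvPolynomial.eval (fun k => x k) (q i) : Vec d) := by
      refine (PiLp.continuous_toLp 2 _).comp (continuous_pi fun i => ?_)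
      exact (MvPolynomial.continuous_eval (q i)).comp (by fun_prop)
    obtain ⟨M, hM⟩ := hc.exists_bound_of_continuousOn hcont.continuousOn
    refine ⟨M, ?_⟩
    filter_upwards [hq] with x hx hxK
    have : V.1.1 x = WithLp.toLp 2 fun i => MvPolynomial.eval (fun k => x k) (q i) := by
      ext i
      exact hx hxK i
    rw [this]
    exact hM x hxK
  choose! M hM using key
  refine ⟨∑ K ∈ T.cells, |M K|, ?_⟩
  have hall : ∀ᵐ x ∂Ω.vol, ∀ K ∈ T.cells, x ∈ convexHull ℝ (K : Set (Vec d)) →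
      ‖V.1.1 x‖ ≤ M K := (Finset.eventually_all _).mpr hM
  filter_upwards [hall, ae_restrict_mem Ω.isOpen.measurableSet] with x hx hxΩ
  have hxc : x ∈ ⋃ K ∈ T.cells, convexHull ℝ (K : Set (Vec d)) := by
    rw [T.cover]
    exact subset_closure hxΩ
  simp only [Set.mem_iUnion] at hxc
  obtain ⟨K, hK, hxK⟩ := hxc
  exact (hx K hK hxK).trans ((le_abs_self _).trans
    (Finset.single_le_sum (f := fun K => |M K|) (fun _ _ => abs_nonneg _) hK))

theorem norm_tensor (v h : Vec d) : ‖tensor v h‖ = ‖v‖ * ‖h‖ := by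
  rw [EuclideanSpace.norm_eq, EuclideanSpace.norm_eq, EuclideanSpace.norm_eq,
    ← Real.sqrt_mul (by positivity), Finset.sum_mul_sum, Fintype.sum_prod_type]
  simp [tensor, mul_pow]

theorem tensor_add (v h h' : Vec d) : tensor v (h + h') = tensor v h + tensor v h' := by
  ext p; simp [tensor, mul_add]

theorem tensor_smul (v : Vec d) (c : ℝ) (h : Vec d) : tensor v (c • h) = c • tensor v h := by
  ext p; simp [tensor, mul_left_comm]

theorem integrable_tensor (P : PolynomialSpaces d) (T : Triangulation Ω) (V : velocitySpace P T)
    (h : Lp (Vec d) 2 Ω.vol) (G : Lp (Mat d) 2 Ω.vol) :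
    Integrable (fun x => inner ℝ (tensor (V.1.1 x) (h x)) (G x)) Ω.vol := by
  obtain ⟨M, hM⟩ := exists_bound P T V
  have hi : Integrable (fun x => M * (‖h x‖ * ‖G x‖)) Ω.vol :=
    ((Lp.memLp h).norm.integrable_mul (Lp.memLp G).norm).const_mul M
  refine hi.mono' ?_ ?_
  · have hc : Continuous fun p : Vec d × Vec d => tensor p.1 p.2 := by
      refine (PiLp.continuous_toLp 2 _).comp (continuous_pi fun i => ?_)
      fun_prop
    exact (hc.comp_aestronglyMeasurable
      ((Lp.aestronglyMeasurable V.1.1).prodMk (Lp.aestronglyMeasurable h))).inner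
      (Lp.aestronglyMeasurable G)
  · filter_upwards [hM] with x hx
    refine (norm_inner_le_norm _ _).trans ?_
    rw [norm_tensor, mul_assoc]
    exact mul_le_mul_of_nonneg_right hx (by positivity)

theorem integrable_convection (P : PolynomialSpaces d) (T : Triangulation Ω)
    (V W H : velocitySpace P T) :
    Integrable (fun x => inner ℝ (tensor (V.1.1 x) (H.1.1 x)) (W.1.2 x)
      - inner ℝ (tensor (V.1.1 x) (W.1.1 x)) (H.1.2 x)) Ω.vol :=
  (integrable_tensor P T V _ _).sub (integrable_tensor P T V _ _)

theorem convection_add (P : PolynomialSpaces d) (T : Triangulation Ω)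
    (V W H H' : velocitySpace P T) :
    convection V.1 W.1 (H + H').1 = convection V.1 W.1 H.1 + convection V.1 W.1 H'.1 := by
  unfold convection
  rw [← mul_add, ← integral_add (integrable_convection P T V W H)
    (integrable_convection P T V W H')]
  congr 1
  refine integral_congr_ae ?_
  filter_upwards [Lp.coeFn_add H.1.1 H'.1.1, Lp.coeFn_add H.1.2 H'.1.2] with x h1 h2
  simp only [Submodule.coe_add, Prod.fst_add, Prod.snd_add, h1, h2, Pi.add_apply, tensor_add,
    inner_add_left, inner_add_right]
  ring

theorem convection_smul (V W : L2Pair Ω) (c : ℝ) (H : L2Pair Ω) :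
    convection V W (c • H) = c * convection V W H := by
  unfold convection
  rw [mul_left_comm, ← integral_const_mul c]
  congr 1
  refine integral_congr_ae ?_
  filter_upwards [Lp.coeFn_smul c H.1, Lp.coeFn_smul c H.2] with x h1 h2
  simp only [Prod.smul_fst, Prod.smul_snd, h1, h2, Pi.smul_apply, tensor_smul,
    real_inner_smul_left, real_inner_smul_right]
  ring

/-- The load functional `f(V) = ∫ f · V`. -/
def load (f : Lp (Vec d) 2 Ω.vol) : L2Pair Ω →ₗ[ℝ] ℝ :=
  innerₗ (Lp (Vec d) 2 Ω.vol) f ∘ₗ LinearMap.fst ℝ _ _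

/-- The operator `F : 𝕍(𝒯) → 𝕍(𝒯)⋆`,
`⟨F(U), V⟩ = a_n(U; U, V) + 𝓑[U, U, V] - f(V)`. -/
def residual (P : PolynomialSpaces d) (T : Triangulation Ω) (σ ν : ℝ) (n : ℕ+)
    (f : Lp (Vec d) 2 Ω.vol) (U : velocitySpace P T) : Module.Dual ℝ (velocitySpace P T) where
  toFun V := viscousForm σ ν n U.1 U.1 V.1 + convection U.1 U.1 V.1 - load f V.1
  map_add' V V' := by
    rw [convection_add, Submodule.coe_add, viscousForm_add, map_add]
    ring
  map_smul' c V := by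
    rw [Submodule.coe_smul, convection_smul, viscousForm_smul, map_smul, RingHom.id_apply,
      smul_eq_mul, smul_eq_mul]
    ring

/-- The Riesz map `J : 𝕍₀(𝒯) → 𝕍₀(𝒯)⋆`, `J(U)(V) = ∫ D U : D V`. The space `𝕍₀(𝒯)` is
finite-dimensional, so that its dual consists of all linear functionals. -/
def rieszMap (P : PolynomialSpaces d) (T : Triangulation Ω) :
    divFreeSpace P T →ₗ[ℝ] Module.Dual ℝ (divFreeSpace P T) :=
  (innerₗ (Lp (Mat d) 2 Ω.vol)).compl₁₂
    (symGrad ∘ₗ (divFreeSpace P T).subtype)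
    (symGrad ∘ₗ (divFreeSpace P T).subtype)

/-- The Zarantonello map `U ↦ U - δ J⁻¹ F(U)` on `𝕍₀(𝒯)`. -/
def zarantonello (P : PolynomialSpaces d) (T : Triangulation Ω) (σ ν : ℝ) (n : ℕ+)
    (f : Lp (Vec d) 2 Ω.vol) (δ : ℝ) (U : divFreeSpace P T) : divFreeSpace P T :=
  U - δ • Function.invFun (rieszMap P T)
    (residual P T σ ν n f (Submodule.inclusion (divFreeSpace_le P T) U) ∘ₗ
      Submodule.inclusion (divFreeSpace_le P T))

/-- The ball `B_R = {U ∈ 𝕍₀(𝒯) : ‖D U‖₂ ≤ R}`. -/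
def velocityBall (P : PolynomialSpaces d) (T : Triangulation Ω) (R : ℝ) :
    Set (divFreeSpace P T) :=
  {U | ‖symGrad U.1‖ ≤ R}

/-- `‖f‖_⋆ = sup {f(V) / ‖D V‖₂ : V ∈ 𝕍₀(𝒯), V ≠ 0}`. -/
def loadNorm (P : PolynomialSpaces d) (T : Triangulation Ω) (f : Lp (Vec d) 2 Ω.vol) : ℝ :=
  sSup {t | ∃ V : divFreeSpace P T, V ≠ 0 ∧ t = load f V.1 / ‖symGrad V.1‖}

/-- The smaller root `(ν - √(ν² - 2√2 C F)) / (2√2 C)`. -/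
def lowerRadius (ν C F : ℝ) : ℝ :=
  (ν - Real.sqrt (ν ^ 2 - 2 * Real.sqrt 2 * C * F)) / (2 * Real.sqrt 2 * C)

/-- The larger root `(ν + √(ν² - 2√2 C F)) / (2√2 C)`. -/
def upperRadius (ν C F : ℝ) : ℝ :=
  (ν + Real.sqrt (ν ^ 2 - 2 * Real.sqrt 2 * C * F)) / (2 * Real.sqrt 2 * C)

end Bingham

end

namespace Bingham

open Filter Topology
open scoped NNReal

variable {d : ℕ} {Ω : BoundedOpenSet d}

/-! ### Sobolev and Poincaré inequalities -/

theorem IsTest.add {F : Type*} [NormedAddCommGroup F] [NormedSpace ℝ F] {φ ψ : Vec d → F}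
    (hφ : IsTest Ω φ) (hψ : IsTest Ω ψ) : IsTest Ω (φ + ψ) :=
  ⟨hφ.1.add hψ.1, hφ.2.1.add hψ.2.1,
    (tsupport_add φ ψ).trans (Set.union_subset hφ.2.2 hψ.2.2)⟩

theorem IsTest.smul {F : Type*} [NormedAddCommGroup F] [NormedSpace ℝ F] {φ : Vec d → F}
    (c : ℝ) (hφ : IsTest Ω φ) : IsTest Ω (c • φ) := by
  have h : tsupport (c • φ) ⊆ tsupport φ := tsupport_smul_subset_right (fun _ => c) φ
  exact ⟨hφ.1.const_smul c, hφ.2.1.mono' ((subset_tsupport _).trans h), h.trans hφ.2.2⟩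

theorem IsTest.differentiable {F : Type*} [NormedAddCommGroup F] [NormedSpace ℝ F]
    {φ : Vec d → F} (hφ : IsTest Ω φ) : Differentiable ℝ φ :=
  hφ.1.differentiable (by simp)

/-- The test pairs form a linear subspace. -/
theorem mem_testPairs_of_mem_span {p : L2Pair Ω} (hp : p ∈ Submodule.span ℝ (testPairs Ω)) :
    p ∈ testPairs Ω := by
  induction hp using Submodule.span_induction with
  | mem p hp => exact hp
  | zero =>
    refine ⟨0, ⟨contDiff_const, .zero, by simp⟩, Lp.coeFn_zero _ _ _, ?_⟩
    filter_upwards [Lp.coeFn_zero (Mat d) 2 Ω.vol] with x hx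
    rw [Prod.snd_zero, hx]
    ext p
    simp [gradMat]
  | add p q _ _ hp hq =>
    obtain ⟨φ, hφ, h1, h2⟩ := hp
    obtain ⟨ψ, hψ, h3, h4⟩ := hq
    refine ⟨φ + ψ, hφ.add hψ, (Lp.coeFn_add _ _).trans (h1.add h3),
      (Lp.coeFn_add _ _).trans ((h2.add h4).trans (.of_forall fun x => ?_))⟩
    ext p
    simp [gradMat, fderiv_add (hφ.differentiable x) (hψ.differentiable x)]
  | smul c p _ hp =>
    obtain ⟨φ, hφ, h1, h2⟩ := hp
    refine ⟨c • φ, hφ.smul c, (Lp.coeFn_smul _ _).trans (h1.const_smul c),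
      (Lp.coeFn_smul _ _).trans ((h2.const_smul c).trans (.of_forall fun x => ?_))⟩
    ext p
    simp [gradMat, fderiv_const_smul (hφ.differentiable x)]

/-- A closed property of the test pairs holds on `W₀^{1,2}(Ω)^d`. -/
theorem sobolevZero_induction {S : Set (L2Pair Ω)} (hS : IsClosed S) (h : testPairs Ω ⊆ S) :
    ∀ p ∈ sobolevZero Ω, p ∈ S := fun _ hp =>
  hS.closure_subset_iff.mpr (fun _ hq => h (mem_testPairs_of_mem_span hq)) hp.2

theorem norm_fderiv_le_norm_gradMat (φ : Vec d → Vec d) (x : Vec d) :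
    ‖fderiv ℝ φ x‖ ≤ ‖gradMat φ x‖ := by
  refine ContinuousLinearMap.opNorm_le_bound _ (norm_nonneg _) fun y => ?_
  refine le_of_sq_le_sq ?_ (by positivity)
  have hy : y = ∑ i, y i • EuclideanSpace.single i (1 : ℝ) := by
    ext j; simp [Pi.single_apply]
  have h : ∀ j, fderiv ℝ φ x y j = ∑ i, gradMat φ x (i, j) * y i := by
    intro j
    conv_lhs => rw [hy, map_sum]
    simp [gradMat, mul_comm]
  rw [EuclideanSpace.real_norm_sq_eq, mul_pow, EuclideanSpace.real_norm_sq_eq,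
    EuclideanSpace.real_norm_sq_eq, Fintype.sum_prod_type_right, Finset.sum_mul]
  refine Finset.sum_le_sum fun j _ => ?_
  rw [h]
  exact Finset.sum_mul_sq_le_sq_mul_sq _ _ _

theorem isClosed_setOf_eLpNorm_le {μ : Measure (Vec d)} (q C : ℝ≥0∞) (hC : C ≠ ⊤) :
    IsClosed {p : Lp (Vec d) 2 μ × Lp (Mat d) 2 μ | eLpNorm p.1 q μ ≤ C * ‖p.2‖ₑ} := by
  refine IsSeqClosed.isClosed fun p p₀ hp hlim => ?_
  have h1 : Tendsto (fun k => (p k).1) atTop (𝓝 p₀.1) := (continuous_fst.tendsto _).comp hlim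
  have h2 : Tendsto (fun k => (p k).2) atTop (𝓝 p₀.2) := (continuous_snd.tendsto _).comp hlim
  obtain ⟨s, hs, hae⟩ := (tendstoInMeasure_of_tendsto_Lp h1).exists_seq_tendsto_ae
  refine (Lp.eLpNorm_lim_le_liminf_eLpNorm
    (fun k => Lp.aestronglyMeasurable (p (s k)).1) _ hae).trans ?_
  refine (liminf_le_liminf (.of_forall fun k => hp (s k))).trans (le_of_eq ?_)
  refine Tendsto.liminf_eq (ENNReal.Tendsto.const_mul ?_ (.inr hC))
  exact (continuous_enorm.tendsto _).comp (h2.comp hs.tendsto_atTop)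

theorem IsTest.exists_eLpNorm_four_le (hd : d = 2 ∨ d = 3) (Ω : BoundedOpenSet d) :
    ∃ c : ℝ≥0, ∀ φ : Vec d → Vec d, IsTest Ω φ →
      eLpNorm φ 4 volume ≤ c * eLpNorm (fderiv ℝ φ) (12 / 7) volume := by
  have hq : ((12 / 7 : ℝ≥0) : ℝ≥0∞) = 12 / 7 := by
    rw [ENNReal.coe_div (by norm_num)]; rfl
  refine ⟨eLpNormLESNormFDerivOfLeConst (Vec d) (volume : Measure (Vec d)) Ω.carrier (12 / 7) 4,
    fun φ hφ => ?_⟩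
  rw [← hq]
  exact eLpNorm_le_eLpNorm_fderiv_of_le (μ := (volume : Measure (Vec d)))
    (hφ.1.of_le (by simp)) ((subset_tsupport φ).trans hφ.2.2) (p := 12 / 7) (q := 4)
    (by rw [one_le_div (by norm_num)]; norm_num)
    (by
      rw [div_lt_iff₀ (by norm_num)]
      rcases hd with rfl | rfl <;> norm_num)
    (by rcases hd with rfl | rfl <;> norm_num) Ω.isBounded

theorem eLpNorm_restrict_of_support_subset {E F : Type*} [MeasurableSpace E]
    [NormedAddCommGroup F] {μ : Measure E} {s : Set E} {f : E → F} (q : ℝ≥0∞)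
    (h : Function.support f ⊆ s) : eLpNorm f q (μ.restrict s) = eLpNorm f q μ :=
  eLpNorm_restrict_eq_of_support_subset h

theorem IsTest.eLpNorm_fderiv_restrict {φ : Vec d → Vec d} (hφ : IsTest Ω φ) (q : ℝ≥0∞) :
    eLpNorm (fderiv ℝ φ) q Ω.vol = eLpNorm (fderiv ℝ φ) q volume :=
  eLpNorm_restrict_of_support_subset q
    ((subset_tsupport _).trans ((tsupport_fderiv_subset ℝ).trans hφ.2.2))

/-- The embedding `W₀^{1,2}(Ω) ⊆ L⁴(Ω)` in two and three dimensions. -/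
theorem exists_eLpNorm_four_le (hd : d = 2 ∨ d = 3) (Ω : BoundedOpenSet d) :
    ∃ C : ℝ≥0, ∀ p ∈ sobolevZero Ω, eLpNorm p.1 4 Ω.vol ≤ C * ‖p.2‖ₑ := by
  obtain ⟨c, hc⟩ := IsTest.exists_eLpNorm_four_le hd Ω
  obtain ⟨m, hm⟩ : ∃ m : ℝ≥0,
      m = Ω.vol Set.univ ^ (1 / (12 / 7 : ℝ≥0∞).toReal - 1 / (2 : ℝ≥0∞).toReal) := by
    refine ⟨_, ENNReal.coe_toNNReal (ENNReal.rpow_ne_top_of_nonneg ?_ (measure_ne_top _ _))⟩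
    norm_num
  refine ⟨c * m, sobolevZero_induction (S := {p | eLpNorm p.1 4 Ω.vol ≤ (c * m : ℝ≥0) * ‖p.2‖ₑ})
    (isClosed_setOf_eLpNorm_le 4 _ ENNReal.coe_ne_top) ?_⟩
  rintro p ⟨φ, hφ, h1, h2⟩
  have hmono : eLpNorm (fderiv ℝ φ) (12 / 7) Ω.vol ≤ ‖p.2‖ₑ * m := by
    calc eLpNorm (fderiv ℝ φ) (12 / 7) Ω.vol
        ≤ eLpNorm p.2 (12 / 7) Ω.vol := by
          refine eLpNorm_mono_ae ?_
          filter_upwards [h2] with x hx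
          rw [hx]
          exact norm_fderiv_le_norm_gradMat φ x
      _ ≤ eLpNorm p.2 2 Ω.vol * m := by
          rw [hm]
          exact eLpNorm_le_eLpNorm_mul_rpow_measure_univ
            (ENNReal.div_le_of_le_mul (by norm_num)) (Lp.aestronglyMeasurable _)
      _ = ‖p.2‖ₑ * m := by rw [Lp.enorm_def]
  rw [Set.mem_ofPred_eq, eLpNorm_congr_ae h1]
  refine (eLpNorm_mono_measure φ Measure.restrict_le_self).trans ((hc φ hφ).trans ?_)
  rw [← hφ.eLpNorm_fderiv_restrict, ENNReal.coe_mul, mul_assoc, mul_comm (m : ℝ≥0∞)]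
  gcongr

/-- Poincaré's inequality. -/
theorem exists_norm_fst_le (hd : d = 2 ∨ d = 3) (Ω : BoundedOpenSet d) :
    ∃ C : ℝ, ∀ p ∈ sobolevZero Ω, ‖p.1‖ ≤ C * sobolevNorm p := by
  obtain ⟨C, hC⟩ := exists_eLpNorm_four_le hd Ω
  set m : ℝ≥0∞ := Ω.vol Set.univ ^ (1 / (2 : ℝ≥0∞).toReal - 1 / (4 : ℝ≥0∞).toReal)
  have hm : m ≠ ⊤ := by
    refine ENNReal.rpow_ne_top_of_nonneg ?_ (measure_ne_top _ _)
    norm_num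
  refine ⟨C * m.toReal, fun p hp => ?_⟩
  have h : ‖p.1‖ₑ ≤ C * ‖p.2‖ₑ * m := by
    rw [Lp.enorm_def]
    exact (eLpNorm_le_eLpNorm_mul_rpow_measure_univ (q := 4) (by norm_num)
      (Lp.aestronglyMeasurable _)).trans (by gcongr; exact hC p hp)
  have h' := ENNReal.toReal_mono (by finiteness) h
  simpa [sobolevNorm, mul_right_comm] using h'

/-! ### Korn's inequality and the convection form -/

theorem norm_sq_eq_integral_norm_sq {ι : Type*} [Fintype ι] {μ : Measure (Vec d)}
    (u : Lp (EuclideanSpace ℝ ι) 2 μ) : ‖u‖ ^ 2 = ∫ x, ‖u x‖ ^ 2 ∂μ := by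
  rw [← real_inner_self_eq_norm_sq, L2.inner_def]
  simp

theorem symGrad_ae_eq (p : L2Pair Ω) : symGrad p =ᵐ[Ω.vol] fun x => symPart (p.2 x) :=
  ContinuousLinearMap.coeFn_compLpL symPart p.2

theorem two_mul_norm_symPart_sq (A : Mat d) :
    2 * ‖symPart A‖ ^ 2 = ‖A‖ ^ 2 + ∑ i, ∑ j, A (i, j) * A (j, i) := by
  have h : ∑ i, ∑ j, A (j, i) ^ 2 = ∑ i, ∑ j, A (i, j) ^ 2 := Finset.sum_comm
  rw [EuclideanSpace.real_norm_sq_eq, EuclideanSpace.real_norm_sq_eq, Fintype.sum_prod_type,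
    Fintype.sum_prod_type]
  have h2 : ∀ i j, symPart A (i, j) = (A (i, j) + A (j, i)) / 2 := fun i j => rfl
  have h3 : ∀ i j, ((A (i, j) + A (j, i)) / 2) ^ 2
      = (1 / 4) * A (i, j) ^ 2 + (1 / 4) * A (j, i) ^ 2 + (1 / 2) * (A (i, j) * A (j, i)) :=
    fun i j => by ring
  simp only [h2, h3, Finset.sum_add_distrib, ← Finset.mul_sum, h]
  ring

/-- The derivatives `∂_a u ∂_b v` and `∂_b u ∂_a v` of functions with compact support have the same
integral. -/
theorem integral_fderiv_mul_fderiv_comm {u v : Vec d → ℝ} (hu : ContDiff ℝ ∞ u)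
    (hv : ContDiff ℝ ∞ v) (hu' : HasCompactSupport u) (a b : Vec d) :
    ∫ x, fderiv ℝ u x a * fderiv ℝ v x b = ∫ x, fderiv ℝ u x b * fderiv ℝ v x a := by
  have hfd : ∀ {w : Vec d → ℝ}, ContDiff ℝ ∞ w → ∀ e : Vec d,
      ContDiff ℝ ∞ fun x => fderiv ℝ w x e := fun hw e =>
    (hw.fderiv_right (m := ∞) (by simp)).clm_apply contDiff_const
  have hfs : ∀ e : Vec d, HasCompactSupport fun x => fderiv ℝ u x e := fun e =>
    (hu'.fderiv ℝ).comp_left (g := fun L : Vec d →L[ℝ] ℝ => L e) rfl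
  have hint : ∀ {f g : Vec d → ℝ}, ContDiff ℝ ∞ f → ContDiff ℝ ∞ g → HasCompactSupport f →
      Integrable fun x => f x * g x := fun hf hg hf' =>
    (hf.continuous.mul hg.continuous).integrable_of_hasCompactSupport hf'.mul_right
  have key : ∀ a b : Vec d, ∫ x, fderiv ℝ u x a * fderiv ℝ v x b
      = -∫ x, u x * fderiv ℝ (fun y => fderiv ℝ v y b) x a := fun a b => by
    rw [integral_mul_fderiv_eq_neg_fderiv_mul_of_integrable
      (hint (hfd hu a) (hfd hv b) (hfs a)) (hint hu (hfd (hfd hv b) a) hu')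
      (hint hu (hfd hv b) hu') (fun x _ => hu.differentiable (by simp) x)
      (fun x _ => (hfd hv b).differentiable (by simp) x), neg_neg]
  rw [key, key]
  congr 2
  ext x
  have hd' : DifferentiableAt ℝ (fderiv ℝ v) x :=
    (hv.fderiv_right (m := ∞) (by simp)).differentiable (by simp) x
  have h1 : ∀ a b : Vec d, fderiv ℝ (fun y => fderiv ℝ v y b) x a
      = fderiv ℝ (fderiv ℝ v) x a b := fun a b => by
    rw [fderiv_clm_apply hd' (differentiableAt_const b)]
    simp
  rw [h1, h1, (hv.contDiffAt.isSymmSndFDerivAt (by simpa using ENat.LEInfty.out)) a b]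

/-- Korn's inequality. -/
theorem sobolevNorm_le_symGrad : ∀ p ∈ sobolevZero Ω, sobolevNorm p ≤ √2 * ‖symGrad p‖ := by
  have hcont : Continuous fun p : L2Pair Ω => ‖symGrad p‖ :=
    ((symPart.compLpL 2 Ω.vol).continuous.comp continuous_snd).norm
  refine sobolevZero_induction (S := {p | sobolevNorm p ≤ √2 * ‖symGrad p‖})
    (isClosed_le continuous_snd.norm (continuous_const.mul hcont)) ?_
  rintro p ⟨φ, hφ, -, h2⟩
  rw [Set.mem_ofPred_eq]
  refine le_of_sq_le_sq ?_ (by positivity)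
  rw [mul_pow, Real.sq_sqrt (by norm_num), sobolevNorm, norm_sq_eq_integral_norm_sq,
    norm_sq_eq_integral_norm_sq, ← integral_const_mul]
  set G : Vec d → Mat d := gradMat φ
  have hG : ∀ i j x, G x (i, j) = fderiv ℝ (fun y => φ y j) x (EuclideanSpace.single i 1) := by
    intro i j x
    have := ((EuclideanSpace.proj j : Vec d →L[ℝ] ℝ).hasFDerivAt.comp x
      (hφ.differentiable x).hasFDerivAt).fderiv
    have h3 : (fun y => φ y j) = (EuclideanSpace.proj j : Vec d →L[ℝ] ℝ) ∘ φ := rfl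
    rw [h3, this]
    rfl
  have hcd : ∀ j, ContDiff ℝ ∞ fun y => φ y j := fun j =>
    (EuclideanSpace.proj j : Vec d →L[ℝ] ℝ).contDiff.comp hφ.1
  have hcs : ∀ j, HasCompactSupport fun y => φ y j := fun j =>
    hφ.2.1.comp_left (g := fun y : Vec d => y j) rfl
  have hGc : ∀ i j, Continuous fun x => G x (i, j) := fun i j => by
    simp only [hG]
    exact ((hcd j).continuous_fderiv (by simp)).clm_apply continuous_const
  have hGs : ∀ i j, HasCompactSupport fun x => G x (i, j) := fun i j => by
    simp only [hG]
    exact ((hcs j).fderiv ℝ).comp_left (g := fun L : Vec d →L[ℝ] ℝ => L _) rfl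
  have hGi : ∀ i j k l, Integrable fun x => G x (i, j) * G x (k, l) := fun i j k l =>
    ((hGc i j).mul (hGc k l)).integrable_of_hasCompactSupport (hGs i j).mul_right
  have hGz : ∀ x, x ∉ Ω.carrier → G x = 0 := fun x hx => by
    have : fderiv ℝ φ x = 0 := by
      by_contra h
      exact hx (hφ.2.2 (tsupport_fderiv_subset ℝ (subset_tsupport _ h)))
    ext q
    simp [G, gradMat, this]
  have e1 : ∫ x, ‖p.2 x‖ ^ 2 ∂Ω.vol = ∫ x, ‖G x‖ ^ 2 ∂Ω.vol :=
    integral_congr_ae (by filter_upwards [h2] with x hx; rw [hx])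
  have e2 : ∫ x, 2 * ‖symGrad p x‖ ^ 2 ∂Ω.vol
      = ∫ x, ‖G x‖ ^ 2 + ∑ i, ∑ j, G x (i, j) * G x (j, i) ∂Ω.vol :=
    integral_congr_ae (by
      filter_upwards [h2, symGrad_ae_eq p] with x hx hx'
      rw [hx', hx, two_mul_norm_symPart_sq])
  have i1 : Integrable (fun x => ∑ i, ∑ j, G x (i, j) * G x (j, i)) :=
    integrable_finsetSum _ fun i _ => integrable_finsetSum _ fun j _ => hGi i j j i
  have i2 : Integrable (fun x => ‖G x‖ ^ 2) := by
    simp only [EuclideanSpace.real_norm_sq_eq]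
    simp only [pow_two]
    exact integrable_finsetSum _ fun q _ => hGi _ _ _ _
  have e3 : ∫ x, ∑ i, ∑ j, G x (i, j) * G x (j, i) ∂Ω.vol = ∫ x, trace (G x) ^ 2 := by
    rw [setIntegral_eq_integral_of_forall_compl_eq_zero (fun x hx => by simp [hGz x hx]),
      integral_finsetSum _ fun i _ => integrable_finsetSum _ fun j _ => hGi i j j i]
    simp only [trace, pow_two, Finset.sum_mul_sum]
    rw [integral_finsetSum _ fun i _ => integrable_finsetSum _ fun j _ => hGi i i j j]
    refine Finset.sum_congr rfl fun i _ => ?_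
    rw [integral_finsetSum _ fun j _ => hGi i j j i, integral_finsetSum _ fun j _ => hGi i i j j]
    refine Finset.sum_congr rfl fun j _ => ?_
    simp only [hG]
    rw [integral_fderiv_mul_fderiv_comm (hcd j) (hcd i) (hcs j)]
    simp only [mul_comm]
  rw [e1, e2, integral_add i2.integrableOn i1.integrableOn, e3]
  have : 0 ≤ ∫ x, trace (G x) ^ 2 := integral_nonneg fun x => sq_nonneg _
  linarith

/-- The convection form is bounded on `W₀^{1,2}(Ω)^d` in two and three dimensions. -/
theorem exists_isConvectionBound (hd : d = 2 ∨ d = 3) (Ω : BoundedOpenSet d) :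
    ∃ C : ℝ, 0 < C ∧ IsConvectionBound Ω C := by
  obtain ⟨C, hC⟩ := exists_eLpNorm_four_le hd Ω
  have : ENNReal.HolderTriple 4 4 2 := ⟨by
    rw [← two_mul, show (4 : ℝ≥0∞) = 2 * 2 by norm_num,
      ENNReal.mul_inv (by norm_num) (by norm_num), ← mul_assoc,
      ENNReal.mul_inv_cancel (by norm_num) (by norm_num), one_mul]⟩
  have hb : ∀ v ∈ sobolevZero Ω, ∀ w ∈ sobolevZero Ω, ∀ G : Lp (Mat d) 2 Ω.vol,
      ∫⁻ x, ‖inner ℝ (tensor (v.1 x) (w.1 x)) (G x)‖ₑ ∂Ω.vol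
        ≤ (C * ‖v.2‖ₑ) * (C * ‖w.2‖ₑ) * ‖G‖ₑ := by
    intro v hv w hw G
    have hc : Continuous fun p : Vec d × Vec d => tensor p.1 p.2 := by
      refine (PiLp.continuous_toLp 2 _).comp (continuous_pi fun i => ?_)
      fun_prop
    have hm := hc.comp_aestronglyMeasurable
      ((Lp.aestronglyMeasurable v.1).prodMk (Lp.aestronglyMeasurable w.1))
    have h1 : eLpNorm (fun x => tensor (v.1 x) (w.1 x)) 2 Ω.vol
        ≤ (C * ‖v.2‖ₑ) * (C * ‖w.2‖ₑ) := by
      refine (eLpNorm_le_eLpNorm_mul_eLpNorm'_of_norm (p := 4) (q := 4)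
        (Lp.aestronglyMeasurable v.1) (Lp.aestronglyMeasurable w.1) tensor 1
        (.of_forall fun x => by simp [norm_tensor])).trans ?_
      rw [ENNReal.coe_one, one_mul]
      gcongr
      · exact hC v hv
      · exact hC w hw
    have h2 := eLpNorm_le_eLpNorm_mul_eLpNorm'_of_norm (p := 2) (q := 2) (r := 1)
      hm (Lp.aestronglyMeasurable G) (fun A B => (inner ℝ A B : ℝ)) 1
      (.of_forall fun x => by simpa using abs_real_inner_le_norm _ _)
    rw [eLpNorm_one_eq_lintegral_enorm, ENNReal.coe_one, one_mul, ← Lp.enorm_def] at h2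
    exact h2.trans (by gcongr)
  refine ⟨C ^ 2 + 1, by positivity, fun v hv w hw h hh => ?_⟩
  have key : ‖∫ x, inner ℝ (tensor (v.1 x) (h.1 x)) (w.2 x)
      - inner ℝ (tensor (v.1 x) (w.1 x)) (h.2 x) ∂Ω.vol‖ₑ
      ≤ 2 * C ^ 2 * ‖v.2‖ₑ * ‖w.2‖ₑ * ‖h.2‖ₑ := by
    refine (enorm_integral_le_lintegral_enorm _).trans ?_
    refine (lintegral_mono fun x => enorm_sub_le).trans ?_
    rw [lintegral_add_left']
    · refine (add_le_add (hb v hv h hh w.2) (hb v hv w hw h.2)).trans (le_of_eq ?_)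
      ring
    · have hc : Continuous fun p : (Vec d × Vec d) × Mat d =>
          (inner ℝ (tensor p.1.1 p.1.2) p.2 : ℝ) := by
        refine Continuous.inner ?_ continuous_snd
        refine (PiLp.continuous_toLp 2 _).comp (continuous_pi fun i => ?_)
        fun_prop
      exact (hc.comp_aestronglyMeasurable (((Lp.aestronglyMeasurable v.1).prodMk
        (Lp.aestronglyMeasurable h.1)).prodMk (Lp.aestronglyMeasurable w.2))).enorm
  have key' := ENNReal.toReal_mono (by finiteness) key
  simp only [ENNReal.toReal_mul, toReal_enorm, ENNReal.toReal_pow, ENNReal.toReal_ofNat,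
    ENNReal.coe_toReal] at key'
  have h0 : 0 ≤ ‖v.2‖ * ‖w.2‖ * ‖h.2‖ := by positivity
  have h1 := (Real.le_norm_self _).trans key'
  unfold convection sobolevNorm
  linarith

/-! ### Finite dimensionality -/

/-- The vector field with polynomial components `q`. -/
noncomputable def polyField (q : Fin d → MvPolynomial (Fin d) ℝ) (x : Vec d) : Vec d :=
  WithLp.toLp 2 fun i => MvPolynomial.eval (fun k => x k) (q i)

theorem continuous_polyField (q : Fin d → MvPolynomial (Fin d) ℝ) : Continuous (polyField q) := by
  refine (PiLp.continuous_toLp 2 _).comp (continuous_pi fun i => ?_)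
  exact (MvPolynomial.continuous_eval (q i)).comp (by fun_prop)

theorem memLp_polyField (Ω : BoundedOpenSet d) (q : Fin d → MvPolynomial (Fin d) ℝ) :
    MemLp (polyField q) 2 Ω.vol := by
  obtain ⟨M, hM⟩ := Ω.isBounded.isCompact_closure.exists_bound_of_continuousOn
    (continuous_polyField q).continuousOn
  refine MemLp.of_bound (continuous_polyField q).aestronglyMeasurable M ?_
  filter_upwards [ae_restrict_mem Ω.isOpen.measurableSet] with x hx
  exact hM x (subset_closure hx)

/-- The restrictions to `s ∩ Ω` of vector fields whose components are polynomials of degree at most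
`m`, as elements of `L²`. -/
noncomputable def polyLp (Ω : BoundedOpenSet d) (m : ℕ) (s : Set (Vec d)) :
    (Fin d → MvPolynomial.restrictTotalDegree (Fin d) ℝ m) →ₗ[ℝ] Lp (Vec d) 2 (Ω.vol.restrict s)
    where
  toFun q := ((memLp_polyField Ω fun i => (q i).1).restrict s).toLp _
  map_add' p q := by
    rw [← MemLp.toLp_add]
    congr 1
    ext x i
    simp [polyField]
  map_smul' c q := by
    rw [RingHom.id_apply, ← MemLp.toLp_const_smul]
    congr 1
    ext x i
    simp [polyField]

theorem restrict_mem_range_polyLp (P : PolynomialSpaces d) (T : Triangulation Ω)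
    (V : velocitySpace P T) (K : T.cells) :
    LpToLpRestrictCLM (Vec d) (Vec d) ℝ Ω.vol 2 (convexHull ℝ (K.1 : Set (Vec d))) V.1.1
      ∈ LinearMap.range (polyLp Ω P.iStar (convexHull ℝ (K.1 : Set (Vec d)))) := by
  have hms : MeasurableSet (convexHull ℝ (K.1 : Set (Vec d))) :=
    (K.1.finite_toSet.isCompact_convexHull ℝ).isClosed.measurableSet
  obtain ⟨q, hq, hq'⟩ := V.2.2 K.1 K.2
  have hdeg := P.velocity_le K.1 hq
  refine ⟨fun i => ⟨q i, hdeg i trivial⟩, Lp.ext ?_⟩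
  refine (MemLp.coeFn_toLp ((memLp_polyField Ω q).restrict _)).trans
    (EventuallyEq.trans ?_ (LpToLpRestrictCLM_coeFn ℝ _ _).symm)
  filter_upwards [ae_restrict_of_ae hq', ae_restrict_mem hms] with x hx hxK
  ext i
  exact (hx hxK i).symm

/-- Restriction of a velocity to the cells. -/
noncomputable def cellwise (P : PolynomialSpaces d) (T : Triangulation Ω) :
    velocitySpace P T →ₗ[ℝ] ∀ K : T.cells,
      LinearMap.range (polyLp Ω P.iStar (convexHull ℝ (K.1 : Set (Vec d)))) :=
  LinearMap.pi fun K => LinearMap.codRestrict _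
    ((LpToLpRestrictCLM (Vec d) (Vec d) ℝ Ω.vol 2
      (convexHull ℝ (K.1 : Set (Vec d)))).toLinearMap ∘ₗ
        LinearMap.fst ℝ _ _ ∘ₗ (velocitySpace P T).subtype)
    fun V => restrict_mem_range_polyLp P T V K

/-- The weak gradient is unique. -/
theorem snd_eq_zero_of_fst_eq_zero {p : L2Pair Ω} (hp : p ∈ sobolev Ω) (h : p.1 = 0) :
    p.2 = 0 := by
  have key : ∀ i j, ∀ᵐ x ∂Ω.vol, p.2 x (i, j) = 0 := by
    intro i j
    rw [ae_restrict_iff' Ω.isOpen.measurableSet]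
    refine Ω.isOpen.ae_eq_zero_of_integral_contDiff_smul_eq_zero ?_ fun φ h1 h2 h3 => ?_
    · have : Integrable (fun x => p.2 x (i, j)) Ω.vol :=
        (memLp_coord p.2 (i, j)).integrable (by norm_num)
      exact IntegrableOn.locallyIntegrableOn this
    · have hw := hp φ ⟨h1, h2, h3⟩ i j
      have h0 : ∫ x, p.1 x j * fderiv ℝ φ x (EuclideanSpace.single i 1) ∂Ω.vol = 0 := by
        refine integral_eq_zero_of_ae ?_
        filter_upwards [Lp.coeFn_zero (Vec d) 2 Ω.vol] with x hx
        rw [h, hx]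
        simp
      rw [h0, eq_comm, neg_eq_zero] at hw
      rw [← hw, setIntegral_eq_integral_of_forall_compl_eq_zero]
      · simp only [smul_eq_mul, mul_comm]
      · intro x hx
        rw [image_eq_zero_of_notMem_tsupport fun hx' => hx (h3 hx'), mul_zero]
  refine Lp.ext ?_
  have hall : ∀ᵐ x ∂Ω.vol, ∀ i j, p.2 x (i, j) = 0 :=
    ae_all_iff.mpr fun i => ae_all_iff.mpr fun j => key i j
  filter_upwards [hall, Lp.coeFn_zero (Mat d) 2 Ω.vol] with x hx h0
  rw [h0]
  ext q
  exact hx q.1 q.2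

theorem cellwise_injective (P : PolynomialSpaces d) (T : Triangulation Ω) :
    Function.Injective (cellwise P T) := by
  rw [← LinearMap.ker_eq_bot, LinearMap.ker_eq_bot']
  intro V hV
  have hK : ∀ K ∈ T.cells, ∀ᵐ x ∂Ω.vol, x ∈ convexHull ℝ (K : Set (Vec d)) → V.1.1 x = 0 := by
    intro K hK
    have hms : MeasurableSet (convexHull ℝ (K : Set (Vec d))) :=
      (K.finite_toSet.isCompact_convexHull ℝ).isClosed.measurableSet
    rw [← ae_restrict_iff' hms]
    have h0 : LpToLpRestrictCLM (Vec d) (Vec d) ℝ Ω.vol 2 (convexHull ℝ (K : Set (Vec d))) V.1.1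
        = 0 := congrArg Subtype.val (congrFun hV ⟨K, hK⟩)
    have h1 := LpToLpRestrictCLM_coeFn ℝ (convexHull ℝ (K : Set (Vec d))) V.1.1
    rw [h0] at h1
    filter_upwards [h1, Lp.coeFn_zero (Vec d) 2 _] with x hx hx0
    rw [← hx, hx0, Pi.zero_apply]
  have hfst : V.1.1 = 0 := by
    refine Lp.ext ?_
    have hall : ∀ᵐ x ∂Ω.vol, ∀ K ∈ T.cells, x ∈ convexHull ℝ (K : Set (Vec d)) → V.1.1 x = 0 :=
      (Finset.eventually_all _).mpr hK
    filter_upwards [hall, ae_restrict_mem Ω.isOpen.measurableSet,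
      Lp.coeFn_zero (Vec d) 2 Ω.vol] with x hx hxΩ hx0
    have hxc : x ∈ ⋃ K ∈ T.cells, convexHull ℝ (K : Set (Vec d)) := by
      rw [T.cover]
      exact subset_closure hxΩ
    simp only [Set.mem_iUnion] at hxc
    obtain ⟨K, hK, hxK⟩ := hxc
    rw [hx K hK hxK, hx0, Pi.zero_apply]
  exact Subtype.ext (Prod.ext hfst (snd_eq_zero_of_fst_eq_zero V.2.1.1 hfst))

theorem finiteDimensional_divFreeSpace (P : PolynomialSpaces d) (T : Triangulation Ω) :
    FiniteDimensional ℝ (divFreeSpace P T) := by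
  have : FiniteDimensional ℝ (velocitySpace P T) :=
    FiniteDimensional.of_injective _ (cellwise_injective P T)
  exact FiniteDimensional.of_injective (Submodule.inclusion (divFreeSpace_le P T))
    (Submodule.inclusion_injective _)

/-! ### The Riesz map and the dual norm -/

theorem mem_sobolevZero {P : PolynomialSpaces d} {T : Triangulation Ω} (V : divFreeSpace P T) :
    V.1 ∈ sobolevZero Ω := V.2.1.1

theorem eq_zero_of_symGrad_eq_zero (hd : d = 2 ∨ d = 3) {p : L2Pair Ω} (hp : p ∈ sobolevZero Ω)
    (h : symGrad p = 0) : p = 0 := by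
  obtain ⟨C, hC⟩ := exists_norm_fst_le hd Ω
  have h2 : sobolevNorm p = 0 := by
    refine le_antisymm ?_ (norm_nonneg _)
    simpa [h] using sobolevNorm_le_symGrad p hp
  have h1 : ‖p.1‖ ≤ 0 := by simpa [h2] using hC p hp
  exact Prod.ext (norm_le_zero_iff.mp h1) (norm_eq_zero.mp h2)

theorem bijective_of_injective_dual {V : Type*} [AddCommGroup V] [Module ℝ V]
    [FiniteDimensional ℝ V] {J : V →ₗ[ℝ] Module.Dual ℝ V} (hJ : Function.Injective J) :
    Function.Bijective J :=
  ⟨hJ, (LinearMap.injective_iff_surjective_of_finrank_eq_finrank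
    Subspace.dual_finrank_eq.symm).mp hJ⟩

theorem rieszMap_apply (P : PolynomialSpaces d) (T : Triangulation Ω) (U V : divFreeSpace P T) :
    rieszMap P T U V = inner ℝ (symGrad U.1) (symGrad V.1) := rfl

theorem rieszMap_bijective (hd : d = 2 ∨ d = 3) (P : PolynomialSpaces d) (T : Triangulation Ω) :
    Function.Bijective (rieszMap P T) := by
  have := finiteDimensional_divFreeSpace P T
  refine bijective_of_injective_dual ?_
  rw [← LinearMap.ker_eq_bot, LinearMap.ker_eq_bot']
  intro V hV
  have h : rieszMap P T V V = 0 := by rw [hV]; rfl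
  rw [rieszMap_apply, inner_self_eq_zero] at h
  exact Subtype.ext (eq_zero_of_symGrad_eq_zero hd (mem_sobolevZero V) h)

theorem load_le (hd : d = 2 ∨ d = 3) (P : PolynomialSpaces d) (T : Triangulation Ω)
    (f : Lp (Vec d) 2 Ω.vol) (V : divFreeSpace P T) :
    load f V.1 ≤ loadNorm P T f * ‖symGrad V.1‖ := by
  obtain ⟨C, hC⟩ := exists_norm_fst_le hd Ω
  have hpos : ∀ V : divFreeSpace P T, V ≠ 0 → 0 < ‖symGrad V.1‖ := fun V hV =>
    norm_pos_iff.mpr fun h =>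
      hV (Subtype.ext (eq_zero_of_symGrad_eq_zero hd (mem_sobolevZero V) h))
  by_cases hV : V = 0
  · simp [hV]
  rw [← div_le_iff₀ (hpos V hV)]
  refine le_csSup ⟨‖f‖ * (|C| * √2), ?_⟩ ⟨V, hV, rfl⟩
  rintro t ⟨W, hW, rfl⟩
  rw [div_le_iff₀ (hpos W hW)]
  have h1 : load f W.1 ≤ ‖f‖ * ‖W.1.1‖ := real_inner_le_norm f W.1.1
  have h2 : ‖W.1.1‖ ≤ |C| * (√2 * ‖symGrad W.1‖) :=
    (hC W.1 (mem_sobolevZero W)).trans (mul_le_mul (le_abs_self C)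
      (sobolevNorm_le_symGrad W.1 (mem_sobolevZero W)) (norm_nonneg _) (abs_nonneg _))
  calc _ ≤ _ := h1
    _ ≤ ‖f‖ * (|C| * (√2 * ‖symGrad W.1‖)) := by gcongr
    _ = _ := by ring

/-! ### The Zarantonello map -/

theorem integral_norm_mul_norm_le {μ : Measure (Vec d)} (A B : Lp (Mat d) 2 μ) :
    ∫ x, ‖A x‖ * ‖B x‖ ∂μ ≤ ‖A‖ * ‖B‖ := by
  have h := real_inner_le_norm ((Lp.memLp B).norm.toLp _) ((Lp.memLp A).norm.toLp _)
  rw [Lp.norm_toLp, Lp.norm_toLp, eLpNorm_norm, eLpNorm_norm, ← Lp.norm_def, ← Lp.norm_def,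
    L2.inner_def, mul_comm ‖B‖] at h
  refine le_trans (le_of_eq (integral_congr_ae ?_)) h
  filter_upwards [(Lp.memLp A).norm.coeFn_toLp, (Lp.memLp B).norm.coeFn_toLp] with x hA hB
  simp [hA, hB]

theorem abs_one_sub_mul_viscosity_le {σ ν : ℝ} (hσ : 0 ≤ σ) (hν : 0 < ν) (n : ℕ+) {δ : ℝ}
    (hδ : 0 < δ) (hδ' : δ ≤ 2 * (4 * ν + σ * n)⁻¹) (A : Mat d) :
    |1 - δ * viscosity σ ν n A| ≤ 1 - 2 * ν * δ := by
  have hn : (0 : ℝ) < n := by exact_mod_cast n.pos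
  have h1 : 2 * ν ≤ viscosity σ ν n A := le_add_of_nonneg_left (by positivity)
  have h2 : viscosity σ ν n A ≤ σ * n + 2 * ν := by
    have := (le_abs_self _).trans (abs_viscosity_le σ ν n A)
    rwa [abs_of_nonneg hσ, abs_of_pos (by positivity : 0 < 2 * ν)] at this
  rw [← div_eq_mul_inv, le_div_iff₀ (by positivity)] at hδ'
  have h3 := mul_le_mul_of_nonneg_left h1 hδ.le
  have h4 := mul_le_mul_of_nonneg_left h2 hδ.le
  rw [abs_le]
  constructor <;> linarith

theorem inner_sub_viscousForm_le {σ ν : ℝ} (hσ : 0 ≤ σ) (hν : 0 < ν) (n : ℕ+) {δ : ℝ}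
    (hδ : 0 < δ) (hδ' : δ ≤ 2 * (4 * ν + σ * n)⁻¹) (U W : L2Pair Ω) :
    inner ℝ (symGrad U) (symGrad W) - δ * viscousForm σ ν n U U W
      ≤ (1 - 2 * ν * δ) * (‖symGrad U‖ * ‖symGrad W‖) := by
  have hi := integrable_viscous σ ν n (symGrad U) (symGrad U) (symGrad W)
  have hc : 0 ≤ 1 - 2 * ν * δ :=
    (abs_nonneg _).trans (abs_one_sub_mul_viscosity_le hσ hν n hδ hδ' (0 : Mat d))
  refine le_trans ?_ (mul_le_mul_of_nonneg_left (integral_norm_mul_norm_le _ _) hc)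
  rw [viscousForm, L2.inner_def, ← integral_const_mul, ← integral_const_mul,
    ← integral_sub (L2.integrable_inner _ _) (hi.const_mul δ)]
  refine integral_mono ((L2.integrable_inner _ _).sub (hi.const_mul δ))
    (((Lp.memLp (symGrad U)).norm.integrable_mul (Lp.memLp (symGrad W)).norm).const_mul _)
    fun x => ?_
  calc _ = (1 - δ * viscosity σ ν n (symGrad U x)) * inner ℝ (symGrad U x) (symGrad W x) := by
        ring
    _ ≤ |1 - δ * viscosity σ ν n (symGrad U x)| * |inner ℝ (symGrad U x) (symGrad W x)| := by
        rw [← abs_mul]; exact le_abs_self _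
    _ ≤ _ := mul_le_mul (abs_one_sub_mul_viscosity_le hσ hν n hδ hδ' _)
        (abs_real_inner_le_norm _ _) (abs_nonneg _) hc

theorem neg_convection_le {C : ℝ} (hC : 0 < C) (hB : IsConvectionBound Ω C) {U W : L2Pair Ω}
    (hU : U ∈ sobolevZero Ω) (hW : W ∈ sobolevZero Ω) :
    -convection U U W ≤ 2 * √2 * C * ‖symGrad U‖ ^ 2 * ‖symGrad W‖ := by
  have h := hB U hU U hU ((-1 : ℝ) • W) (Submodule.smul_mem _ _ hW)
  rw [convection_smul, neg_one_mul] at h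
  have hn : sobolevNorm ((-1 : ℝ) • W) = sobolevNorm W := by simp [sobolevNorm]
  have h0 : ∀ p : L2Pair Ω, 0 ≤ sobolevNorm p := fun p => norm_nonneg _
  have hs : √2 ^ 2 = 2 := Real.sq_sqrt (by norm_num)
  rw [hn] at h
  calc _ ≤ C * sobolevNorm U * sobolevNorm U * sobolevNorm W := h
    _ ≤ C * (√2 * ‖symGrad U‖) * (√2 * ‖symGrad U‖) * (√2 * ‖symGrad W‖) := by
        have hU' := sobolevNorm_le_symGrad U hU
        have hW' := sobolevNorm_le_symGrad W hW
        have := h0 U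
        have := h0 W
        gcongr
    _ = √2 ^ 2 * √2 * C * ‖symGrad U‖ ^ 2 * ‖symGrad W‖ := by ring
    _ = _ := by rw [hs]

theorem norm_symGrad_zarantonello_le (hd : d = 2 ∨ d = 3) (P : PolynomialSpaces d)
    (T : Triangulation Ω) {σ ν : ℝ} (hσ : 0 ≤ σ) (hν : 0 < ν) (f : Lp (Vec d) 2 Ω.vol) {C : ℝ}
    (hC : 0 < C) (hB : IsConvectionBound Ω C) (n : ℕ+) {δ : ℝ} (hδ : 0 < δ)
    (hδ' : δ ≤ 2 * (4 * ν + σ * n)⁻¹) (U : divFreeSpace P T) :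
    ‖symGrad (zarantonello P T σ ν n f δ U).1‖ ≤ max 0 ((1 - 2 * ν * δ) * ‖symGrad U.1‖
      + δ * (2 * √2 * C * ‖symGrad U.1‖ ^ 2 + loadNorm P T f)) := by
  set W := zarantonello P T σ ν n f δ U with hWdef
  have hJ : rieszMap P T W = rieszMap P T U
      - δ • (residual P T σ ν n f (Submodule.inclusion (divFreeSpace_le P T) U) ∘ₗ
        Submodule.inclusion (divFreeSpace_le P T)) := by
    rw [hWdef, zarantonello, map_sub, map_smul,
      Function.rightInverse_invFun (rieszMap_bijective hd P T).2]
  have hW : rieszMap P T W W = inner ℝ (symGrad U.1) (symGrad W.1)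
      - δ * (viscousForm σ ν n U.1 U.1 W.1 + convection U.1 U.1 W.1 - load f W.1) := by
    conv_lhs => rw [hJ]
    rfl
  rw [rieszMap_apply, real_inner_self_eq_norm_sq] at hW
  have h1 := inner_sub_viscousForm_le hσ hν n hδ hδ' U.1 W.1
  have h2 := mul_le_mul_of_nonneg_left
    (neg_convection_le hC hB (mem_sobolevZero U) (mem_sobolevZero W)) hδ.le
  have h3 := mul_le_mul_of_nonneg_left (load_le hd P T f W) hδ.le
  rcases (norm_nonneg (symGrad W.1)).eq_or_lt with h0 | h0
  · exact h0.symm.le.trans (le_max_left _ _)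
  · refine le_trans (le_of_mul_le_mul_right ?_ h0) (le_max_right _ _)
    linarith

theorem quadratic_nonpos_of_mem_Icc {ν C F R : ℝ} (hC : 0 < C)
    (hF : F < ν ^ 2 / (2 * √2 * C)) (h1 : lowerRadius ν C F ≤ R) (h2 : R ≤ upperRadius ν C F) :
    2 * √2 * C * R ^ 2 + F ≤ 2 * ν * R := by
  have ha : 0 < 2 * √2 * C := by positivity
  rw [lt_div_iff₀ ha] at hF
  rw [lowerRadius, div_le_iff₀ ha] at h1
  rw [upperRadius, le_div_iff₀ ha] at h2
  set a := 2 * √2 * C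
  have hs : √(ν ^ 2 - a * F) ^ 2 = ν ^ 2 - a * F := Real.sq_sqrt (by linarith)
  have h3 : (R * a - ν) ^ 2 ≤ √(ν ^ 2 - a * F) ^ 2 := sq_le_sq' (by linarith) (by linarith)
  rw [hs] at h3
  have h4 : a * (a * R ^ 2 + F) ≤ a * (2 * ν * R) := by linarith
  exact le_of_mul_le_mul_left h4 ha

theorem mapsTo_zarantonello (hd : d = 2 ∨ d = 3) (P : PolynomialSpaces d)
    (T : Triangulation Ω) {σ ν : ℝ} (hσ : 0 ≤ σ) (hν : 0 < ν) (f : Lp (Vec d) 2 Ω.vol) {C : ℝ}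
    (hC : 0 < C) (hB : IsConvectionBound Ω C) {F R : ℝ} (hfF : loadNorm P T f ≤ F)
    (hF : F < ν ^ 2 / (2 * √2 * C)) (h1 : lowerRadius ν C F ≤ R) (h2 : R ≤ upperRadius ν C F)
    (n : ℕ+) {δ : ℝ} (hδ : 0 < δ) (hδ' : δ ≤ 2 * (4 * ν + σ * n)⁻¹) :
    Set.MapsTo (zarantonello P T σ ν n f δ) (velocityBall P T R) (velocityBall P T R) := by
  intro U hU
  have hU : ‖symGrad U.1‖ ≤ R := hU
  have hR : 0 ≤ R := (norm_nonneg _).trans hU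
  have hc : 0 ≤ 1 - 2 * ν * δ :=
    (abs_nonneg _).trans (abs_one_sub_mul_viscosity_le hσ hν n hδ hδ' (0 : Mat d))
  refine (norm_symGrad_zarantonello_le hd P T hσ hν f hC hB n hδ hδ' U).trans (max_le hR ?_)
  calc _ ≤ (1 - 2 * ν * δ) * R + δ * (2 * √2 * C * R ^ 2 + F) := by gcongr
    _ ≤ (1 - 2 * ν * δ) * R + δ * (2 * ν * R) := by
        gcongr
        exact quadratic_nonpos_of_mem_Icc hC hF h1 h2
    _ = R := by ring

end Bingham

theorem mainTheorem7 {d : ℕ} (hd : d = 2 ∨ d = 3) (Ω : Bingham.BoundedOpenSet d)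
    (P : Bingham.PolynomialSpaces d) (T : ℕ → Bingham.Triangulation Ω)
    (σ ν : ℝ) (hσ : 0 ≤ σ) (hν : 0 < ν) (f : MeasureTheory.Lp (Bingham.Vec d) 2 Ω.vol) :
    (∃ C : ℝ, 0 < C ∧ Bingham.IsConvectionBound Ω C) ∧
    (∀ N : ℕ, Function.Bijective (Bingham.rieszMap P (T N))) ∧
    ∀ C : ℝ, 0 < C → Bingham.IsConvectionBound Ω C →
      (∀ N : ℕ, Bingham.loadNorm P (T N) f < ν ^ 2 / (2 * Real.sqrt 2 * C) →
        ∀ R : ℝ, Bingham.lowerRadius ν C (Bingham.loadNorm P (T N) f) ≤ R →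
          R ≤ Bingham.upperRadius ν C (Bingham.loadNorm P (T N) f) →
          ∀ (n : ℕ+) (δ : ℝ), 0 < δ → δ ≤ 2 * (4 * ν + σ * n)⁻¹ →
            Set.MapsTo (Bingham.zarantonello P (T N) σ ν n f δ)
              (Bingham.velocityBall P (T N) R) (Bingham.velocityBall P (T N) R)) ∧
      (∀ F : ℝ, (∀ N : ℕ, Bingham.loadNorm P (T N) f ≤ F) → F < ν ^ 2 / (2 * Real.sqrt 2 * C) →
        ∀ R : ℝ, Bingham.lowerRadius ν C F ≤ R → R ≤ Bingham.upperRadius ν C F →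
          ∀ (N : ℕ) (n : ℕ+) (δ : ℝ), 0 < δ → δ ≤ 2 * (4 * ν + σ * n)⁻¹ →
            Set.MapsTo (Bingham.zarantonello P (T N) σ ν n f δ)
              (Bingham.velocityBall P (T N) R) (Bingham.velocityBall P (T N) R)) := by
  refine ⟨Bingham.exists_isConvectionBound hd Ω, fun N => Bingham.rieszMap_bijective hd P (T N),
    fun C hC hB => ⟨fun N hF R h1 h2 n δ hδ hδ' => ?_, fun F hfF hF R h1 h2 N n δ hδ hδ' => ?_⟩⟩
  · exact Bingham.mapsTo_zarantonello hd P (T N) hσ hν f hC hB le_rfl hF h1 h2 n hδ hδ'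
  · exact Bingham.mapsTo_zarantonello hd P (T N) hσ hν f hC hB (hfF N) hF h1 h2 n hδ hδ'
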